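/- Let $n,m\ge 0$ be integers and write $[n]=\{1,\dots,n\}$. A chain in $2^{[n]}$ is a (possibly empty) family of subsets of $[n]$ that are pairwise comparable under inclusion. A chain $C_1\subsetneq C_2\subsetneq\dots\subsetneq C_r$ is called skipless if $|C_{i+1}|=|C_i|+1$ for all $1\le i<r$. Suppose that $\mathcal F\subseteq 2^{[n]}$ admits a chain decomposition into $m$ chains, i.e. $\mathcal F=\bigcup_{i=1}^m D^i$ for some pairwise disjoint chains $D^1,\dots,D^m$. Then there exist pairwise disjoint skipless chains $C^1,\dots,C^m$ in $2^{[n]}$ such that $\mathcal F\subseteq\bigcup_{i=1}^m C^i$. -/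

import Mathlib

/-- A set system `C ⊆ 2^[n]` whose elements are pairwise comparable under inclusion
(the empty system is allowed). -/
def IsSetChain {n : ℕ} (C : Finset (Finset (Fin n))) : Prop :=
  IsChain (· ⊆ ·) (C : Set (Finset (Fin n)))

/-- `A` is immediately followed by `B` in `C`: both lie in `C`, `A ⊊ B`, and no element of `C`
lies strictly between them. -/
def ConsecutiveIn {n : ℕ} (C : Finset (Finset (Fin n))) (A B : Finset (Fin n)) : Prop :=
  A ∈ C ∧ B ∈ C ∧ A ⊂ B ∧ ∀ Z ∈ C, ¬ (A ⊂ Z ∧ Z ⊂ B)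

/-- A skipless chain: a chain in which consecutive elements differ in size by exactly one. -/
structure IsSkiplessChain {n : ℕ} (C : Finset (Finset (Fin n))) : Prop where
  chain : IsSetChain C
  skipless : ∀ A B : Finset (Fin n), ConsecutiveIn C A B → B.card = A.card + 1

/-- The family `C` of `m` pairwise disjoint chains is a chain decomposition of `F`:
the chains have union exactly `F`. -/
structure IsChainDecomposition {n m : ℕ} (F : Finset (Finset (Fin n)))
    (C : Fin m → Finset (Finset (Fin n))) : Prop where
  chain : ∀ i, IsSetChain (C i)
  disjoint : ∀ i j, i ≠ j → Disjoint (C i) (C j)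
  union : F = Finset.univ.biUnion C

/-!
Every set `v` is to be given a predecessor: a set that it covers, or `v` itself if `v ∉ F` (then
`v` is left out of the chains), or one of `m` markers (then `v` is the bottom of a chain).
An injective choice of predecessors is the same as `m` disjoint skipless chains covering `F`
(`exists_skipless_chains_of_predecessor`), and by Hall's theorem it exists if every family `S`
satisfies `#S ≤ #N(S) + m`, where `N(S) = ∂ S ∪ (S \ F)`.

To prove this inequality, let `I` minimise `#N(S) - #S`. If `I` is a lower set, then `I \ N(I)`
consists of members of `F` that are maximal in `I`, which form an antichain; an antichain in a
union of `m` chains has at most `m` members. It remains to see that `W = ∂ I \ I` is empty.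
Minimality and Hall's theorem give an injection `p` from `W` into `I` with `w ⋖ p w`, and an
injection `q` from `W` into the complement of `∂ I` with `q w ⋖ w`. If `t ⋖ w ⋖ v` with `v ∈ I` and
`t ∉ ∂ I`, then the fourth vertex of the diamond from `t` to `v` lies in `W` too. Therefore `p w`
covers at least one more member of `W` than there are sets outside `∂ I` covered by `w`, and `q w`
is covered by at least one more member of `W` than there are members of `I` covering `w`. Summing
over `W`, each of the numbers of edges from `W` up to `I` and from `W` down to the complement of
`∂ I` exceeds the other by at least `#W`, so `W = ∅`.
-/

open scoped FinsetFamily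

/-! ### Shadows and diamonds -/

theorem mem_shadow_iff_exists_covBy {α : Type*} [DecidableEq α] {I : Finset (Finset α)}
    {t : Finset α} : t ∈ ∂ I ↔ ∃ v ∈ I, t ⋖ v := by
  rw [Finset.mem_shadow_iff_insert_mem]
  constructor
  · rintro ⟨a, ha, h⟩
    exact ⟨_, h, Finset.covBy_insert ha⟩
  · rintro ⟨v, hv, h⟩
    obtain ⟨a, ha, rfl⟩ := Finset.covBy_iff_exists_insert.1 h
    exact ⟨a, ha, hv⟩

/-- The fourth vertex of a diamond: it is `insert a t` if `w = insert b t` and `v = insert a w`. -/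
theorem covBy_sdiff_sdiff {α : Type*} [DecidableEq α] {t w v : Finset α} (htw : t ⋖ w)
    (hwv : w ⋖ v) : t ⋖ v \ (w \ t) ∧ v \ (w \ t) ⋖ v ∧ v \ (w \ t) ≠ w := by
  obtain ⟨b, hb, rfl⟩ := Finset.covBy_iff_exists_insert.1 htw
  obtain ⟨a, ha, rfl⟩ := Finset.covBy_iff_exists_insert.1 hwv
  have hab : a ≠ b := fun h => ha (h ▸ Finset.mem_insert_self _ _)
  have hat : a ∉ t := fun h => ha (Finset.mem_insert_of_mem h)
  have key : insert a (insert b t) \ (insert b t \ t) = insert a t := by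
    ext c
    simp only [Finset.mem_sdiff, Finset.mem_insert]
    grind
  rw [key]
  refine ⟨Finset.covBy_insert hat, ?_, ?_⟩
  · rw [Finset.insert_comm]
    exact Finset.covBy_insert (by simp [hab.symm, hb])
  · intro h
    exact ha (h ▸ Finset.mem_insert_self _ _)

section Boundary

variable {α : Type*} [DecidableEq α] {I : Finset (Finset α)} {t w v : Finset α}

theorem sdiff_sdiff_mem_shadow_sdiff (hv : v ∈ I) (ht : t ∉ ∂ I) (htw : t ⋖ w) (hwv : w ⋖ v) :
    v \ (w \ t) ∈ ∂ I \ I := by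
  obtain ⟨h1, h2, -⟩ := covBy_sdiff_sdiff htw hwv
  exact Finset.mem_sdiff.2 ⟨mem_shadow_iff_exists_covBy.2 ⟨v, hv, h2⟩,
    fun h => ht (mem_shadow_iff_exists_covBy.2 ⟨_, h, h1⟩)⟩

open Classical in
theorem card_below_lt_card_below [Fintype α] (hw : w ∈ ∂ I \ I) (hv : v ∈ I) (hwv : w ⋖ v) :
    ((∂ I)ᶜ.filter (· ⋖ w)).card < ((∂ I \ I).filter (· ⋖ v)).card := by
  have hmem : w ∈ (∂ I \ I).filter (· ⋖ v) := Finset.mem_filter.2 ⟨hw, hwv⟩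
  refine lt_of_le_of_lt ?_ (Finset.card_erase_lt_of_mem hmem)
  refine Finset.card_le_card_of_injOn (fun t => v \ (w \ t)) ?_ ?_
  · intro t ht
    obtain ⟨ht, htw⟩ := Finset.mem_filter.1 ht
    obtain ⟨-, h2, h3⟩ := covBy_sdiff_sdiff htw hwv
    exact Finset.mem_erase.2 ⟨h3, Finset.mem_filter.2
      ⟨sdiff_sdiff_mem_shadow_sdiff hv (Finset.mem_compl.1 ht) htw hwv, h2⟩⟩
  · intro t ht t' ht' h
    have h1 := (Finset.mem_filter.1 ht).2.le
    have h2 := (Finset.mem_filter.1 ht').2.le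
    have h3 := hwv.le
    ext c
    have := Finset.ext_iff.1 h c
    have := @h1 c
    have := @h2 c
    have := @h3 c
    simp only [Finset.mem_sdiff] at *
    tauto

open Classical in
theorem card_above_lt_card_above (hw : w ∈ ∂ I \ I) (ht : t ∉ ∂ I) (htw : t ⋖ w) :
    (I.filter (w ⋖ ·)).card < ((∂ I \ I).filter (t ⋖ ·)).card := by
  have hmem : w ∈ (∂ I \ I).filter (t ⋖ ·) := Finset.mem_filter.2 ⟨hw, htw⟩
  refine lt_of_le_of_lt ?_ (Finset.card_erase_lt_of_mem hmem)
  refine Finset.card_le_card_of_injOn (fun v => v \ (w \ t)) ?_ ?_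
  · intro v hv
    obtain ⟨hv, hwv⟩ := Finset.mem_filter.1 hv
    obtain ⟨h1, -, h3⟩ := covBy_sdiff_sdiff htw hwv
    exact Finset.mem_erase.2 ⟨h3, Finset.mem_filter.2
      ⟨sdiff_sdiff_mem_shadow_sdiff hv ht htw hwv, h1⟩⟩
  · intro v hv v' hv' h
    have h1 := (Finset.mem_filter.1 hv).2.le
    have h2 := (Finset.mem_filter.1 hv').2.le
    ext c
    have := Finset.ext_iff.1 h c
    have := @h1 c
    have := @h2 c
    simp only [Finset.mem_sdiff] at *
    tauto

end Boundary

/-- If `W` is matched injectively into `B` by edges of `r`, the degrees in `W` of the matched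
vertices add up to at most the number of edges between `W` and `B`. -/
theorem sum_card_filter_le_of_injective {α β : Type*} [DecidableEq β] (r : α → β → Prop)
    [∀ a b, Decidable (r a b)] {W : Finset α} {B : Finset β} {p : W → β}
    (hp : Function.Injective p) (hpB : ∀ w, p w ∈ B) :
    ∑ w : W, (W.filter (r · (p w))).card ≤ ∑ w : W, (B.filter (r w ·)).card := by
  rw [Finset.sum_coe_sort W (fun w => (B.filter (r w ·)).card)]
  change _ ≤ ∑ w ∈ W, (B.bipartiteAbove r w).card
  rw [Finset.sum_card_bipartiteAbove_eq_sum_card_bipartiteBelow]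
  rw [← Finset.sum_image (s := Finset.univ) (g := p)
    (f := fun b => (W.filter (r · b)).card) (fun a _ b _ h => hp h)]
  refine Finset.sum_le_sum_of_subset ?_
  intro b hb
  obtain ⟨w, -, rfl⟩ := Finset.mem_image.1 hb
  exact hpB w

/-- The double count over diamonds: matchings of `∂ I \ I` both up into `I` and down into the
complement of `∂ I` can only coexist if `I` is a lower set. -/
theorem shadow_subset_of_matchings {α : Type*} [Fintype α] [DecidableEq α]
    {I : Finset (Finset α)} {p q : ↥(∂ I \ I) → Finset α}
    (hp : Function.Injective p) (hpI : ∀ w, p w ∈ I) (hpw : ∀ w : ↥(∂ I \ I), (w : Finset α) ⋖ p w)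
    (hq : Function.Injective q) (hqI : ∀ w, q w ∉ ∂ I) (hqw : ∀ w, q w ⋖ (w : Finset α)) :
    ∂ I ⊆ I := by
  classical
  have h1 := sum_card_filter_le_of_injective (W := ∂ I \ I) (· ⋖ ·) hp hpI
  have h2 := sum_card_filter_le_of_injective (W := ∂ I \ I) (B := (∂ I)ᶜ)
    (fun w t : Finset α => t ⋖ w) hq (fun w => Finset.mem_compl.2 (hqI w))
  rw [← Finset.sdiff_eq_empty_iff_subset]
  by_contra hne
  obtain ⟨w₀, hw₀⟩ := Finset.nonempty_iff_ne_empty.2 hne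
  have hne' : (Finset.univ : Finset ↥(∂ I \ I)).Nonempty := ⟨⟨w₀, hw₀⟩, Finset.mem_univ _⟩
  have h3 := Finset.sum_lt_sum_of_nonempty hne'
    (fun w _ => card_below_lt_card_below w.2 (hpI w) (hpw w))
  have h4 := Finset.sum_lt_sum_of_nonempty hne'
    (fun w _ => card_above_lt_card_above w.2 (hqI w) (hqw w))
  omega

/-! ### The deficiency inequality -/

/-- The sets that can be predecessors of members of `S`, when only sets outside `F` may be their
own predecessors. -/
def predecessors {α : Type*} [DecidableEq α] (F S : Finset (Finset α)) : Finset (Finset α) :=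
  ∂ S ∪ S \ F

/-- A family minimising `#(predecessors F S) - #S` is a lower set; the subtraction-free form of
minimality is used. -/
theorem shadow_subset_of_minimal {α : Type*} [Fintype α] [DecidableEq α]
    {F I : Finset (Finset α)}
    (hI : ∀ S, (predecessors F I).card + S.card ≤ (predecessors F S).card + I.card) :
    ∂ I ⊆ I := by
  classical
  -- Removing from `I` the sets that cover a member of `W'` frees `W'`.
  have hup : ∀ W' : Finset ↥(∂ I \ I),
      W'.card ≤ (W'.biUnion fun w => I.filter ((w : Finset α) ⋖ ·)).card := by
    intro W'
    set P := W'.biUnion fun w => I.filter ((w : Finset α) ⋖ ·) with hP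
    have hPI : P ⊆ I := Finset.biUnion_subset.2 fun w _ => Finset.filter_subset _ _
    have h1 := hI (I \ P)
    have h2 := Finset.card_sdiff_add_card_eq_card hPI
    have hW : W'.map (Function.Embedding.subtype _) ⊆ predecessors F I := by
      intro w hw
      obtain ⟨w, -, rfl⟩ := Finset.mem_map.1 hw
      exact Finset.mem_union_left _ (Finset.mem_sdiff.1 w.2).1
    have h3 := Finset.card_sdiff_add_card_eq_card hW
    rw [Finset.card_map] at h3
    have h4 : predecessors F (I \ P) ⊆
        predecessors F I \ W'.map (Function.Embedding.subtype _) := by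
      intro t ht
      rw [Finset.mem_sdiff]
      refine ⟨Finset.union_subset_union (Finset.shadow_mono Finset.sdiff_subset)
        (Finset.sdiff_subset_sdiff Finset.sdiff_subset le_rfl) ht, fun htW => ?_⟩
      obtain ⟨w, hw, rfl⟩ := Finset.mem_map.1 htW
      rcases Finset.mem_union.1 ht with h | h
      · obtain ⟨v, hv, hwv⟩ := mem_shadow_iff_exists_covBy.1 h
        obtain ⟨hv, hvP⟩ := Finset.mem_sdiff.1 hv
        exact hvP (Finset.mem_biUnion.2 ⟨w, hw, Finset.mem_filter.2 ⟨hv, hwv⟩⟩)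
      · exact (Finset.mem_sdiff.1 w.2).2 (Finset.mem_sdiff.1 (Finset.mem_sdiff.1 h).1).1
    have h5 := Finset.card_le_card h4
    omega
  -- Adding `W'` to `I` costs only the sets outside `∂ I` covered by a member of `W'`.
  have hdown : ∀ W' : Finset ↥(∂ I \ I),
      W'.card ≤ (W'.biUnion fun w => (∂ I)ᶜ.filter (· ⋖ (w : Finset α))).card := by
    intro W'
    set T := W'.biUnion fun w => (∂ I)ᶜ.filter (· ⋖ (w : Finset α)) with hT
    have h1 := hI (I ∪ W'.map (Function.Embedding.subtype _))
    have hd : Disjoint I (W'.map (Function.Embedding.subtype _)) := by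
      rw [Finset.disjoint_right]
      intro w hw
      obtain ⟨w, -, rfl⟩ := Finset.mem_map.1 hw
      exact (Finset.mem_sdiff.1 w.2).2
    rw [Finset.card_union_of_disjoint hd, Finset.card_map] at h1
    have h4 : predecessors F (I ∪ W'.map (Function.Embedding.subtype _)) ⊆
        predecessors F I ∪ T := by
      intro t ht
      rcases Finset.mem_union.1 ht with h | h
      · by_cases htI : t ∈ ∂ I
        · exact Finset.mem_union_left _ (Finset.mem_union_left _ htI)
        obtain ⟨v, hv, htv⟩ := mem_shadow_iff_exists_covBy.1 h
        rcases Finset.mem_union.1 hv with hv | hv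
        · exact absurd (mem_shadow_iff_exists_covBy.2 ⟨v, hv, htv⟩) htI
        · obtain ⟨w, hw, rfl⟩ := Finset.mem_map.1 hv
          exact Finset.mem_union_right _ (Finset.mem_biUnion.2
            ⟨w, hw, Finset.mem_filter.2 ⟨Finset.mem_compl.2 htI, htv⟩⟩)
      · obtain ⟨h, htF⟩ := Finset.mem_sdiff.1 h
        refine Finset.mem_union_left _ ?_
        rcases Finset.mem_union.1 h with h | h
        · exact Finset.mem_union_right _ (Finset.mem_sdiff.2 ⟨h, htF⟩)
        · obtain ⟨w, -, rfl⟩ := Finset.mem_map.1 h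
          exact Finset.mem_union_left _ (Finset.mem_sdiff.1 w.2).1
    have h5 := (Finset.card_le_card h4).trans (Finset.card_union_le _ _)
    omega
  obtain ⟨p, hp, hp'⟩ := (Finset.all_card_le_biUnion_card_iff_exists_injective _).1 hup
  obtain ⟨q, hq, hq'⟩ := (Finset.all_card_le_biUnion_card_iff_exists_injective _).1 hdown
  simp only [Finset.mem_filter, Finset.mem_compl] at hp' hq'
  exact shadow_subset_of_matchings hp (fun w => (hp' w).1) (fun w => (hp' w).2)
    hq (fun w => (hq' w).1) (fun w => (hq' w).2)

/-- A lower set `I` fails to contain predecessors only for the members of `F` that are maximal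
in `I`. -/
theorem isAntichain_sdiff_predecessors {α : Type*} [DecidableEq α] {F I : Finset (Finset α)}
    (hI : ∂ I ⊆ I) : IsAntichain (· ⊆ ·) (I \ predecessors F I : Set (Finset α)) := by
  have key : ∀ k : ℕ, ∀ u ∈ I, ∀ v, v ⊂ u → u.card = v.card + k → v ∈ ∂ I := by
    intro k
    induction k with
    | zero => intro u _ v hvu h; exact absurd (Finset.card_lt_card hvu) (by omega)
    | succ k ih =>
      intro u hu v hvu h
      obtain ⟨a, hau, hav⟩ := Finset.exists_of_ssubset hvu
      have hmem : u.erase a ∈ ∂ I := Finset.erase_mem_shadow hu hau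
      have hsub : v ⊆ u.erase a := Finset.subset_erase.2 ⟨hvu.1, hav⟩
      rcases hsub.eq_or_ssubset with h' | h'
      · exact h' ▸ hmem
      · exact ih _ (hI hmem) v h' (by rw [Finset.card_erase_of_mem hau]; omega)
  intro v hv u hu hne hvu
  have hlt : v ⊂ u := (Finset.ssubset_iff_subset_ne).2 ⟨hvu, hne⟩
  have := Finset.card_lt_card hlt
  exact hv.2 (Finset.mem_union_left _ (key (u.card - v.card) u hu.1 v hlt (by omega)))

theorem card_le_card_predecessors_add {n m : ℕ} {F : Finset (Finset (Fin n))}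
    {D : Fin m → Finset (Finset (Fin n))} (hD : IsChainDecomposition F D)
    (S : Finset (Finset (Fin n))) : S.card ≤ (predecessors F S).card + m := by
  obtain ⟨I, hI⟩ := Finite.exists_min
    (fun S : Finset (Finset (Fin n)) => ((predecessors F S).card : ℤ) - S.card)
  have hlow : ∂ I ⊆ I := shadow_subset_of_minimal (F := F) fun S => by have := hI S; omega
  have hF : I \ predecessors F I ⊆ F := by
    intro v hv
    obtain ⟨hv, hv'⟩ := Finset.mem_sdiff.1 hv
    by_contra hvF
    exact hv' (Finset.mem_union_right _ (Finset.mem_sdiff.2 ⟨hv, hvF⟩))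
  have hanti : (I \ predecessors F I).card ≤ m := by
    have hex : ∀ v : Finset (Fin n), v ∈ I \ predecessors F I → ∃ i, v ∈ D i := by
      intro v hv
      have h := hF hv
      rw [hD.union] at h
      simpa using h
    rcases Finset.eq_empty_or_nonempty (I \ predecessors F I) with h | ⟨v₀, hv₀⟩
    · simp [h]
    have : Nonempty (Fin m) := ⟨(hex v₀ hv₀).choose⟩
    choose! c hc using hex
    rw [← Finset.card_fin m]
    refine Finset.card_le_card_of_injOn c (fun _ _ => Finset.mem_univ _) ?_
    intro u hu v hv huv
    by_contra hne
    have hA := isAntichain_sdiff_predecessors (F := F) hlow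
    rw [← Finset.coe_sdiff] at hA
    rcases (hD.chain (c u)) (hc u hu) (huv ▸ hc v hv) hne with h | h
    · exact hA hu hv hne h
    · exact hA hv hu (Ne.symm hne) h
  have h1 := Finset.le_card_sdiff (predecessors F I) I
  have h2 := hI S
  omega

/-! ### From a predecessor map to chains -/

/-- Following the predecessor map `g` from a set leads, by proper steps down, to the marker `i`. -/
inductive ReachesMarker {α : Type*} {m : ℕ} (g : Finset α → Finset α ⊕ Fin m) (i : Fin m) :
    Finset α → Prop
  | bottom {v : Finset α} : g v = Sum.inr i → ReachesMarker g i v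
  | step {v w : Finset α} : g v = Sum.inl w → w ⋖ v → ReachesMarker g i w → ReachesMarker g i v

section ReachesMarker

variable {α : Type*} {m : ℕ} {g : Finset α → Finset α ⊕ Fin m} {i j : Fin m}

theorem ReachesMarker.unique {v : Finset α} (hi : ReachesMarker g i v)
    (hj : ReachesMarker g j v) : i = j := by
  induction hi with
  | bottom h =>
    cases hj with
    | bottom h' => exact Sum.inr_injective (h.symm.trans h')
    | step h' => simp [h] at h'
  | step h _ _ ih =>
    cases hj with
    | bottom h' => simp [h] at h'
    | step h' _ hw =>
      obtain rfl := Sum.inl_injective (h.symm.trans h')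
      exact ih hw

theorem ReachesMarker.bottom_subset (hg : Function.Injective g) {b v : Finset α}
    (hb : g b = Sum.inr i) (hv : ReachesMarker g i v) : b ⊆ v := by
  induction hv with
  | bottom h => exact (hg (hb.trans h.symm)).subset
  | step _ hwv _ ih => exact ih.trans hwv.le

theorem card_add_one_of_covBy {s t : Finset α} (h : s ⋖ t) : t.card = s.card + 1 := by
  classical
  obtain ⟨a, ha, rfl⟩ := Finset.covBy_iff_exists_insert.1 h
  exact Finset.card_insert_of_notMem ha

theorem ReachesMarker.subset_of_card_le (hg : Function.Injective g) {u v : Finset α}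
    (hv : ReachesMarker g i v) (hu : ReachesMarker g i u) (huv : u.card ≤ v.card) : u ⊆ v := by
  induction hv generalizing u with
  | bottom h => exact (Finset.eq_of_subset_of_card_le (hu.bottom_subset hg h) huv).ge
  | @step v w h hwv hw ih =>
    have hc := card_add_one_of_covBy hwv
    by_cases hle : u.card ≤ w.card
    · exact (ih hu hle).trans hwv.le
    cases hu with
    | bottom hu => exact (ReachesMarker.step h hwv hw).bottom_subset hg hu
    | @step _ w' hu hw'u hw' =>
      have hc' := card_add_one_of_covBy hw'u
      obtain rfl := Finset.eq_of_subset_of_card_le (ih hw' (by omega)) (by omega)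
      exact (hg (hu.trans h.symm)).subset

/-- A proper step cannot lead to a set that is its own predecessor, since `g` is injective. -/
theorem exists_reachesMarker {F : Finset (Finset α)} (hg : Function.Injective g)
    (hgF : ∀ v w, g v = Sum.inl w → w ⋖ v ∨ w = v ∧ v ∉ F) {v : Finset α}
    (hv : g v ≠ Sum.inl v) : ∃ i, ReachesMarker g i v := by
  induction v using Finset.strongInduction with
  | H v ih =>
    rcases hw : g v with w | i
    · rcases hgF v w hw with h | ⟨rfl, -⟩
      · obtain ⟨i, hi⟩ := ih w h.lt fun hww => h.ne (hg (hww.trans hw.symm))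
        exact ⟨i, .step hw h hi⟩
      · exact absurd hw hv
    · exact ⟨i, .bottom hw⟩

end ReachesMarker

theorem exists_skipless_chains_of_predecessor {n m : ℕ} {F : Finset (Finset (Fin n))}
    {g : Finset (Fin n) → Finset (Fin n) ⊕ Fin m} (hg : Function.Injective g)
    (hgF : ∀ v w, g v = Sum.inl w → w ⋖ v ∨ w = v ∧ v ∉ F) :
    ∃ C : Fin m → Finset (Finset (Fin n)),
      (∀ i, IsSkiplessChain (C i)) ∧
      (∀ i j, i ≠ j → Disjoint (C i) (C j)) ∧
      F ⊆ Finset.univ.biUnion C := by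
  classical
  refine ⟨fun i => Finset.univ.filter (ReachesMarker g i), fun i => ⟨?_, ?_⟩, ?_, ?_⟩
  · intro u hu v hv _
    simp only [Finset.coe_filter, Finset.mem_univ, true_and, Set.mem_ofPred_eq] at hu hv
    rcases le_total u.card v.card with h | h
    · exact Or.inl (hv.subset_of_card_le hg hu h)
    · exact Or.inr (hu.subset_of_card_le hg hv h)
  · rintro A B ⟨hA, hB, hAB, hno⟩
    simp only [Finset.mem_filter, Finset.mem_univ, true_and] at hA hB hno
    have hlt := Finset.card_lt_card hAB
    cases hB with
    | bottom h => exact absurd (hA.bottom_subset hg h) hAB.2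
    | @step _ w h hwB hw =>
      have hc := card_add_one_of_covBy hwB
      have hAw : A ⊆ w := hw.subset_of_card_le hg hA (by omega)
      rcases hAw.eq_or_ssubset with rfl | h'
      · exact hc
      · exact absurd ⟨h', hwB.lt⟩ (hno w hw)
  · intro i j hij
    rw [Finset.disjoint_left]
    intro v hi hj
    exact hij ((Finset.mem_filter.1 hi).2.unique (Finset.mem_filter.1 hj).2)
  · intro v hv
    have hloop : g v ≠ Sum.inl v := by
      intro h
      rcases hgF v v h with h' | h'
      · exact h'.ne rfl
      · exact h'.2 hv
    obtain ⟨i, hi⟩ := exists_reachesMarker hg hgF hloop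
    exact Finset.mem_biUnion.2 ⟨i, Finset.mem_univ _, Finset.mem_filter.2 ⟨Finset.mem_univ _, hi⟩⟩

theorem theorem1p2 (n m : ℕ) (F : Finset (Finset (Fin n)))
    (hF : ∃ D : Fin m → Finset (Finset (Fin n)), IsChainDecomposition F D) :
    ∃ C : Fin m → Finset (Finset (Fin n)),
      (∀ i, IsSkiplessChain (C i)) ∧
      (∀ i j, i ≠ j → Disjoint (C i) (C j)) ∧
      F ⊆ Finset.univ.biUnion C := by
  obtain ⟨D, hD⟩ := hF
  have hall : ∀ S : Finset (Finset (Fin n)), S.card ≤ (S.biUnion fun v =>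
      (predecessors F {v}).disjSum (Finset.univ : Finset (Fin m))).card := by
    intro S
    rcases S.eq_empty_or_nonempty with rfl | ⟨v₀, hv₀⟩
    · simp
    have hsub : (predecessors F S).disjSum (Finset.univ : Finset (Fin m)) ⊆
        S.biUnion fun v => (predecessors F {v}).disjSum Finset.univ := by
      intro x hx
      rw [Finset.mem_biUnion]
      rcases x with w | i
      · rw [Finset.inl_mem_disjSum] at hx
        rcases Finset.mem_union.1 hx with h | h
        · obtain ⟨v, hv, hwv⟩ := mem_shadow_iff_exists_covBy.1 h
          exact ⟨v, hv, Finset.inl_mem_disjSum.2 (Finset.mem_union_left _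
            (mem_shadow_iff_exists_covBy.2 ⟨v, Finset.mem_singleton_self v, hwv⟩))⟩
        · obtain ⟨hw, hwF⟩ := Finset.mem_sdiff.1 h
          exact ⟨w, hw, Finset.inl_mem_disjSum.2 (Finset.mem_union_right _
            (Finset.mem_sdiff.2 ⟨Finset.mem_singleton_self w, hwF⟩))⟩
      · exact ⟨v₀, hv₀, Finset.inr_mem_disjSum.2 (Finset.mem_univ i)⟩
    have h1 := Finset.card_le_card hsub
    rw [Finset.card_disjSum, Finset.card_fin] at h1
    exact (card_le_card_predecessors_add hD S).trans h1
  obtain ⟨g, hg, hg'⟩ := (Finset.all_card_le_biUnion_card_iff_exists_injective _).1 hall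
  refine exists_skipless_chains_of_predecessor hg fun v w h => ?_
  have hw := hg' v
  rw [h, Finset.inl_mem_disjSum] at hw
  rcases Finset.mem_union.1 hw with hw | hw
  · obtain ⟨u, hu, hwu⟩ := mem_shadow_iff_exists_covBy.1 hw
    exact Or.inl (Finset.mem_singleton.1 hu ▸ hwu)
  · obtain ⟨hw, hwF⟩ := Finset.mem_sdiff.1 hw
    obtain rfl := Finset.mem_singleton.1 hw
    exact Or.inr ⟨rfl, hwF⟩
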